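/- Work over $\mathbb{C}$. Let $n,k\ge 0$ be integers, let $Y=(\mathbb{P}^n)^k$, let $\nu:Y\to\mathbb{P}^M$, $M=(n+1)^k-1$, be the Segre embedding, where $\mathbb{P}^M=\mathbb{P}((\mathbb{C}^{n+1})^{\otimes k})$ is the space of tensors up to scalars, and let $v_k:\mathbb{P}^n\to\mathbb{P}^M$ be the Veronese map, i.e. the restriction of $\nu$ to the diagonal of $Y$, whose image spans the space of symmetric tensors. For a closed subscheme, $\langle\cdot\rangle$ denotes the linear span of its image, i.e. the intersection of all hyperplanes containing it. For $T\in\mathbb{P}^M$, the cactus rank of $T$ is the minimal degree of a zero-dimensional closed subscheme $Z\subset Y$ with $T\in\langle\nu(Z)\rangle$, and the rank of $T$ is the minimal cardinality of a finite set $S\subset Y$ with $T\in\langle\nu(S)\rangle$; the symmetric rank of $T$ is the minimal cardinality of a finite set $S\subset\mathbb{P}^n$ with $T\in\langle v_k(S)\rangle$. Let $A\subset\mathbb{P}^n$ be a zero-dimensional scheme of degree $c+1$ ($c\ge 0$) with ideal sheaf $\mathcal{J}_A$, and assume that $h^1(\mathbb{P}^n,\mathcal{J}_A(e))=0$ for some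 integer $e$ with $0\le e\le k/2$. Let $T\in\langle v_k(A)\rangle$ be such that $T\notin\langle v_k(A')\rangle$ for every closed subscheme $A'\subsetneq A$. Then $T$ has cactus rank $c+1$. If moreover $A$ is reduced (i.e. a finite set of points), then $T$ has rank $c+1$ and symmetric rank $c+1$; in particular the rank and the symmetric rank of $T$ coincide, i.e. Comon's conjecture holds for $T$. -/

import Mathlib

open MvPolynomial
open scoped TensorProduct LinearAlgebra.Projectivization

noncomputable section

namespace TensorRank

/-! ## Zero-dimensional subschemes of projective space -/

/-- A closed subscheme of `ℙⁿ` over `ℂ`, given by its saturated homogeneous ideal: the closed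
subschemes of `ℙⁿ = Proj ℂ[x₀, …, xₙ]` correspond bijectively to the homogeneous ideals `I`
that are saturated with respect to the irrelevant ideal `(x₀, …, xₙ)`.
The empty subscheme is the unit ideal. -/
@[ext]
structure ProjSubscheme (n : ℕ) where
  /-- The ideal of all polynomials that vanish on the subscheme. -/
  ideal : Ideal (MvPolynomial (Fin (n + 1)) ℂ)
  homogeneous : ∀ f ∈ ideal, ∀ d, homogeneousComponent d f ∈ ideal
  saturated : ∀ f, (∀ i, ∃ N : ℕ, X i ^ N * f ∈ ideal) → f ∈ ideal

theorem prod_X_pow_isHomogeneous {n : ℕ} (s : Multiset (Fin (n + 1))) (N : ℕ) :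
    (((s.map X).prod : MvPolynomial (Fin (n + 1)) ℂ) ^ N).IsHomogeneous (N * s.card) := by
  have h : ((s.map X).prod : MvPolynomial (Fin (n + 1)) ℂ).IsHomogeneous s.card := by
    induction s using Multiset.induction_on with
    | empty => simpa using isHomogeneous_one (Fin (n + 1)) ℂ
    | cons a t ih => simpa [add_comm] using (isHomogeneous_X ℂ a).mul ih
  simpa [mul_comm] using h.pow N

namespace ProjSubscheme

variable {n : ℕ}

/-- The Hilbert function `d ↦ dim (S / I)_d` of a closed subscheme. -/
def hilbertFunction (A : ProjSubscheme n) (d : ℕ) : ℕ :=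
  Module.finrank ℂ (homogeneousSubmodule (Fin (n + 1)) ℂ d ⧸
    (A.ideal.restrictScalars ℂ).submoduleOf (homogeneousSubmodule (Fin (n + 1)) ℂ d))

/-- `A` is zero-dimensional (or empty, if `r = 0`) of degree `r`: its Hilbert polynomial is the
constant `r`. -/
def HasDegree (A : ProjSubscheme n) (r : ℕ) : Prop :=
  ∃ m : ℕ, ∀ d, m ≤ d → A.hilbertFunction d = r

/-- `A' ⊊ A`. -/
def IsProperSubscheme (A' A : ProjSubscheme n) : Prop :=
  A.ideal < A'.ideal

/-- `A` is a reduced scheme. -/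
def IsReduced (A : ProjSubscheme n) : Prop :=
  A.ideal.IsRadical

/-! ### First cohomology of the twisted ideal sheaf

The cohomology of `𝒥_A(e)` is computed by the Čech complex of the standard affine cover
`U_i = {x_i ≠ 0}`. All modules of sections are regarded as subspaces of the fraction field of the
homogeneous coordinate ring, so that the restriction maps are inclusions. -/

/-- The sections of `𝒥_A(e)` on the open set `⋂_{i ∈ s} U_i = {∏_{i ∈ s} x_i ≠ 0}`, i.e. the part of
degree `e` of the localization of `I` at `∏_{i ∈ s} x_i`: all fractions
`f / (∏_{i ∈ s} x_i) ^ N` with `f ∈ I` homogeneous of degree `e + N |s|`.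
Here `s` is a list `i, j, …` of indices, with repetitions allowed. -/
def idealSheafSections (A : ProjSubscheme n) (e : ℕ) (s : Multiset (Fin (n + 1))) :
    Submodule ℂ (FractionRing (MvPolynomial (Fin (n + 1)) ℂ)) where
  carrier := {g | ∃ (N : ℕ) (f : MvPolynomial (Fin (n + 1)) ℂ), f ∈ A.ideal ∧
    f.IsHomogeneous (e + N * s.card) ∧
    g * algebraMap _ _ ((s.map X).prod ^ N) = algebraMap _ _ f}
  zero_mem' := ⟨0, 0, A.ideal.zero_mem, isHomogeneous_zero _ _ _, by simp⟩
  add_mem' := by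
    rintro g₁ g₂ ⟨N₁, f₁, h₁, d₁, e₁⟩ ⟨N₂, f₂, h₂, d₂, e₂⟩
    have key := fun N : ℕ => prod_X_pow_isHomogeneous s N
    refine ⟨N₁ + N₂, f₁ * (s.map X).prod ^ N₂ + f₂ * (s.map X).prod ^ N₁,
      A.ideal.add_mem (A.ideal.mul_mem_right _ h₁) (A.ideal.mul_mem_right _ h₂), ?_, ?_⟩
    · refine IsHomogeneous.add ?_ ?_
      · have := d₁.mul (key N₂)
        rwa [add_assoc, ← add_mul] at this
      · have := d₂.mul (key N₁)
        rwa [add_assoc, ← add_mul, add_comm N₂] at this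
    · rw [map_add, RingHom.map_mul, RingHom.map_mul, ← e₁, ← e₂, pow_add,
        RingHom.map_mul]
      ring
  smul_mem' := by
    rintro a g ⟨N, f, h, d, e⟩
    refine ⟨N, a • f, ?_, ?_, ?_⟩
    · rw [MvPolynomial.smul_eq_C_mul]
      exact A.ideal.mul_mem_left _ h
    · exact (homogeneousSubmodule (Fin (n + 1)) ℂ _).smul_mem a d
    · rw [smul_mul_assoc, e, Algebra.smul_def, Algebra.smul_def, map_mul,
        ← IsScalarTower.algebraMap_apply]

/-- Čech 1-cocycles of `𝒥_A(e)`: families `g_{ij} ∈ Γ(U_i ∩ U_j, 𝒥_A(e))` with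
`g_{jk} - g_{ik} + g_{ij} = 0` on `U_i ∩ U_j ∩ U_k`. -/
def cechCocycles (A : ProjSubscheme n) (e : ℕ) :
    Submodule ℂ (Fin (n + 1) → Fin (n + 1) → FractionRing (MvPolynomial (Fin (n + 1)) ℂ)) where
  carrier := {g | (∀ i j, g i j ∈ A.idealSheafSections e {i, j}) ∧
    ∀ i j k, g j k - g i k + g i j = 0}
  zero_mem' := ⟨fun _ _ => Submodule.zero_mem _, fun _ _ _ => by simp⟩
  add_mem' := by
    rintro g g' ⟨h₁, h₂⟩ ⟨h₁', h₂'⟩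
    refine ⟨fun i j => Submodule.add_mem _ (h₁ i j) (h₁' i j), fun i j k => ?_⟩
    simp only [Pi.add_apply]
    linear_combination h₂ i j k + h₂' i j k
  smul_mem' := by
    rintro a g ⟨h₁, h₂⟩
    refine ⟨fun i j => Submodule.smul_mem _ a (h₁ i j), fun i j k => ?_⟩
    simp only [Pi.smul_apply]
    rw [← smul_sub, ← smul_add, h₂, smul_zero]

/-- Čech 1-coboundaries of `𝒥_A(e)`: families `h_j - h_i` with `h_i ∈ Γ(U_i, 𝒥_A(e))`. -/
def cechCoboundaries (A : ProjSubscheme n) (e : ℕ) :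
    Submodule ℂ (Fin (n + 1) → Fin (n + 1) → FractionRing (MvPolynomial (Fin (n + 1)) ℂ)) where
  carrier := {g | ∃ h : Fin (n + 1) → FractionRing (MvPolynomial (Fin (n + 1)) ℂ),
    (∀ i, h i ∈ A.idealSheafSections e {i}) ∧ ∀ i j, g i j = h j - h i}
  zero_mem' := ⟨0, fun _ => Submodule.zero_mem _, fun _ _ => by simp⟩
  add_mem' := by
    rintro g g' ⟨h, h₁, h₂⟩ ⟨h', h₁', h₂'⟩
    refine ⟨h + h', fun i => Submodule.add_mem _ (h₁ i) (h₁' i), fun i j => ?_⟩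
    simp only [Pi.add_apply, h₂, h₂']
    ring
  smul_mem' := by
    rintro a g ⟨h, h₁, h₂⟩
    refine ⟨a • h, fun i => Submodule.smul_mem _ a (h₁ i), fun i j => ?_⟩
    simp only [Pi.smul_apply, h₂, smul_sub]

/-- `H¹(ℙⁿ, 𝒥_A(e))`. -/
abbrev H1 (A : ProjSubscheme n) (e : ℕ) : Type :=
  A.cechCocycles e ⧸ (A.cechCoboundaries e).submoduleOf (A.cechCocycles e)

/-- `h¹(𝒥_A(e)) = dim H¹(ℙⁿ, 𝒥_A(e))`. -/
def h1 (A : ProjSubscheme n) (e : ℕ) : Cardinal :=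
  Module.rank ℂ (A.H1 e)

end ProjSubscheme

/-! ## Zero-dimensional subschemes of `Y = ℙⁿ × ⋯ × ℙⁿ` -/

/-- The multidegree of the variable `x_{i,j}` (the `j`-th coordinate on the `i`-th factor) of the
Cox ring `ℂ[x_{i,j}]` of `Y = (ℙⁿ)ᵏ` is the `i`-th unit vector. -/
def multiWeight (k n : ℕ) (v : Fin k × Fin (n + 1)) : Fin k → ℕ :=
  Pi.single v.1 1

/-- The forms of multidegree `u` on `(ℙⁿ)ᵏ`. -/
abbrev multiForms (k n : ℕ) (u : Fin k → ℕ) :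
    Submodule ℂ (MvPolynomial (Fin k × Fin (n + 1)) ℂ) :=
  weightedHomogeneousSubmodule ℂ (multiWeight k n) u

/-- A closed subscheme of `Y = (ℙⁿ)ᵏ` over `ℂ`, given by its multihomogeneous ideal, saturated with
respect to the irrelevant ideal, which is generated by the monomials `x_{1,j₁} ⋯ x_{k,jₖ}`
(the charts `{x_{1,j₁} ⋯ x_{k,jₖ} ≠ 0}` form the standard affine cover of `Y`). -/
@[ext]
structure MultiProjSubscheme (k n : ℕ) where
  /-- The ideal of all polynomials that vanish on the subscheme. -/
  ideal : Ideal (MvPolynomial (Fin k × Fin (n + 1)) ℂ)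
  homogeneous : ∀ f ∈ ideal, ∀ u, weightedHomogeneousComponent (multiWeight k n) u f ∈ ideal
  saturated : ∀ f, (∀ j : Fin k → Fin (n + 1), ∃ N : ℕ, (∏ i, X (i, j i)) ^ N * f ∈ ideal) →
    f ∈ ideal

namespace MultiProjSubscheme

variable {k n : ℕ}

/-- The multigraded Hilbert function `u ↦ dim (S / I)_u` of a closed subscheme of `(ℙⁿ)ᵏ`. -/
def hilbertFunction (Z : MultiProjSubscheme k n) (u : Fin k → ℕ) : ℕ :=
  Module.finrank ℂ (multiForms k n u ⧸
    (Z.ideal.restrictScalars ℂ).submoduleOf (multiForms k n u))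

/-- `Z` is zero-dimensional (or empty, if `r = 0`) of degree `r`: its multigraded Hilbert polynomial
is the constant `r`. -/
def HasDegree (Z : MultiProjSubscheme k n) (r : ℕ) : Prop :=
  ∃ m : ℕ, ∀ u : Fin k → ℕ, (∀ i, m ≤ u i) → Z.hilbertFunction u = r

end MultiProjSubscheme

/-! ## Tensors, the Segre map, the Veronese map and linear spans -/

/-- Tensors of type `(n+1) × ⋯ × (n+1)` (`k` factors). -/
abbrev Tensor (k n : ℕ) : Type :=
  ⨂[ℂ]^k (Fin (n + 1) → ℂ)

/-- The standard basis tensor `e_{a₁} ⊗ ⋯ ⊗ e_{aₖ}`. -/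
def basisTensor {k n : ℕ} (a : Fin k → Fin (n + 1)) : Tensor k n :=
  PiTensorProduct.tprod ℂ fun i => (Pi.single (a i) 1 : Fin (n + 1) → ℂ)

/-- The pull back `ν^* L` of a linear form `L` on the space of tensors by the Segre map
`ν : (ℙⁿ)ᵏ → ℙ^M`, `(x₁, …, xₖ) ↦ x₁ ⊗ ⋯ ⊗ xₖ`. -/
def segrePullback {k n : ℕ} (L : Module.Dual ℂ (Tensor k n)) :
    MvPolynomial (Fin k × Fin (n + 1)) ℂ :=
  ∑ a : Fin k → Fin (n + 1), C (L (basisTensor a)) * ∏ i, X (i, a i)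

/-- The pull back `v_k^* L` of a linear form `L` on the space of tensors by the Veronese map
`x ↦ x ⊗ ⋯ ⊗ x`, the restriction of the Segre map to the diagonal. -/
def veronesePullback {k n : ℕ} (L : Module.Dual ℂ (Tensor k n)) :
    MvPolynomial (Fin (n + 1)) ℂ :=
  ∑ a : Fin k → Fin (n + 1), C (L (basisTensor a)) * ∏ i, X (a i)

/-- The linear span `⟨ν(Z)⟩`, as a linear subspace of the space of tensors: the intersection of all
hyperplanes `{L = 0}` that contain the scheme `ν(Z)`. -/
def MultiProjSubscheme.segreSpan {k n : ℕ} (Z : MultiProjSubscheme k n) :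
    Submodule ℂ (Tensor k n) :=
  ⨅ (L : Module.Dual ℂ (Tensor k n)) (_ : segrePullback L ∈ Z.ideal), LinearMap.ker L

/-- The linear span `⟨v_k(A)⟩`, as a linear subspace of the space of tensors: the intersection of
all hyperplanes `{L = 0}` that contain the scheme `v_k(A)`. It consists of symmetric tensors. -/
def ProjSubscheme.veroneseSpan {n : ℕ} (A : ProjSubscheme n) (k : ℕ) :
    Submodule ℂ (Tensor k n) :=
  ⨅ (L : Module.Dual ℂ (Tensor k n)) (_ : veronesePullback L ∈ A.ideal), LinearMap.ker L

/-- A representative of the point `ν(p₁, …, pₖ)`. -/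
def segrePoint {k n : ℕ} (p : Fin k → ℙ ℂ (Fin (n + 1) → ℂ)) : Tensor k n :=
  PiTensorProduct.tprod ℂ fun i => (p i).rep

/-! ## Ranks -/

/-- `r` is the rank of `T`: the minimal cardinality of a finite set `S ⊂ Y` with `T ∈ ⟨ν(S)⟩`. -/
def IsRank {k n : ℕ} (T : ℙ ℂ (Tensor k n)) (r : ℕ) : Prop :=
  IsLeast {s : ℕ | ∃ S : Finset (Fin k → ℙ ℂ (Fin (n + 1) → ℂ)), S.card = s ∧
    T.submodule ≤ Submodule.span ℂ (segrePoint '' (S : Set (Fin k → ℙ ℂ (Fin (n + 1) → ℂ))))} r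

/-- `r` is the symmetric rank of `T`: the minimal cardinality of a finite set `S ⊂ ℙⁿ` with
`T ∈ ⟨v_k(S)⟩`. -/
def IsSymmetricRank {k n : ℕ} (T : ℙ ℂ (Tensor k n)) (r : ℕ) : Prop :=
  IsLeast {s : ℕ | ∃ S : Finset (ℙ ℂ (Fin (n + 1) → ℂ)), S.card = s ∧
    T.submodule ≤ Submodule.span ℂ
      ((fun p => segrePoint (k := k) fun _ => p) '' (S : Set (ℙ ℂ (Fin (n + 1) → ℂ))))} r

/-- `r` is the cactus rank of `T`: the minimal degree of a zero-dimensional scheme `Z ⊂ Y` with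
`T ∈ ⟨ν(Z)⟩`. -/
def IsCactusRank {k n : ℕ} (T : ℙ ℂ (Tensor k n)) (r : ℕ) : Prop :=
  IsLeast {s : ℕ | ∃ Z : MultiProjSubscheme k n, Z.HasDegree s ∧ T.submodule ≤ Z.segreSpan} r

end TensorRank

end

/-!
The proof compares `T` with its flattening. For `k = e + e'` with `e ≤ e'`, the tensor `T` pairs
multilinear forms on the first `e` factors with multilinear forms on the last `e'` factors. If `T`
lies in the span of a scheme or of a finite set of points, then every form on the first `e` factors
that vanishes there is orthogonal to all forms on the remaining factors. So the rank of this pairing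
is at most the Hilbert function of the scheme in the corresponding multidegree, hence at most its
degree, respectively at most the number of points (`MultiProjSubscheme.le_hilbertFunction`,
`ProjSubscheme.le_card_of_mem_span`).

On the other hand, the rank is at least `c + 1`. Because `h¹(𝒥_A(e)) = 0`, the Hilbert function of
`A` is `c + 1` from degree `e` on (`ProjSubscheme.hilbertFunction_eq_of_h1_eq_zero`, by an explicit
computation with Čech cocycles). As `T` is in `⟨v_k(A)⟩`, the pairing factors through restriction to
the diagonal, modulo the ideal of `A`. It is nondegenerate there: were a form `f` of degree `e`, not
vanishing on `A`, orthogonal to all forms of degree `e'`, then `T` would be in the span of the proper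
subscheme `A ∩ {f = 0}`, against the minimality of `A`
(`ProjSubscheme.multilinearForm_mem_of_orthogonal`). Thus the rank of the pairing is the dimension
`c + 1` of the space of forms of degree `e` modulo those that vanish on `A`.

The bounds are attained. The diagonal image of `A` has degree `c + 1`; its Hilbert function is
bounded above by that of `A` and below by the argument just given. If `A` is reduced, then by the
Nullstellensatz `⟨v_k(A)⟩` is spanned by the images of the at most `c + 1` points of `A`.
-/

noncomputable section

open Module

namespace TensorRank

/-! ### Dimensions of quotients -/

/-- Here `g` need not map `p` to `q`: it induces an injection of a quotient of `V` that maps onto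
`V ⧸ p`. -/
theorem finrank_quotient_le_of_comap_le {V W : Type*} [AddCommGroup V] [Module ℂ V]
    [AddCommGroup W] [Module ℂ W] [Module.Finite ℂ W] {p : Submodule ℂ V} {q : Submodule ℂ W}
    (g : V →ₗ[ℂ] W) (h : q.comap g ≤ p) : finrank ℂ (V ⧸ p) ≤ finrank ℂ (W ⧸ q) := by
  have hinj : Function.Injective ((q.comap g).mapQ q g le_rfl) := by
    rw [← LinearMap.ker_eq_bot]
    exact Submodule.ker_liftQ_eq_bot _ _ _ (by rw [LinearMap.ker_comp, Submodule.ker_mkQ])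
  have : Module.Finite ℂ (V ⧸ q.comap g) := Module.Finite.of_injective _ hinj
  exact (LinearMap.finrank_le_finrank_of_surjective (Submodule.factor_surjective h)).trans
    (LinearMap.finrank_le_finrank_of_injective hinj)

/-- The condition `hg` says that `g` is onto modulo `q`. -/
theorem finrank_quotient_le_of_forall_exists {V W : Type*} [AddCommGroup V] [Module ℂ V]
    [AddCommGroup W] [Module ℂ W] [Module.Finite ℂ V] {p : Submodule ℂ V} {q : Submodule ℂ W}
    (g : V →ₗ[ℂ] W) (h : p ≤ q.comap g) (hg : ∀ w, ∃ v, g v - w ∈ q) :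
    finrank ℂ (W ⧸ q) ≤ finrank ℂ (V ⧸ p) := by
  refine LinearMap.finrank_le_finrank_of_surjective (f := p.mapQ q g h) fun w => ?_
  obtain ⟨w, rfl⟩ := q.mkQ_surjective w
  obtain ⟨v, hv⟩ := hg w
  exact ⟨p.mkQ v, (Submodule.Quotient.eq q).2 hv⟩

/-- A map that is injective modulo `p` and `q` is onto modulo `q` if the quotients have the same
dimension. -/
theorem forall_exists_of_finrank_quotient_eq {V W : Type*} [AddCommGroup V] [Module ℂ V]
    [AddCommGroup W] [Module ℂ W] [Module.Finite ℂ V] [Module.Finite ℂ W]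
    {p : Submodule ℂ V} {q : Submodule ℂ W} (g : V →ₗ[ℂ] W) (h : q.comap g = p)
    (hpq : finrank ℂ (V ⧸ p) = finrank ℂ (W ⧸ q)) (w : W) : ∃ v, g v - w ∈ q := by
  subst h
  have hinj : Function.Injective ((q.comap g).mapQ q g le_rfl) := by
    rw [← LinearMap.ker_eq_bot]
    exact Submodule.ker_liftQ_eq_bot _ _ _ (by rw [LinearMap.ker_comp, Submodule.ker_mkQ])
  obtain ⟨v, hv⟩ := (LinearMap.injective_iff_surjective_of_finrank_eq_finrank hpq).1 hinj (q.mkQ w)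
  obtain ⟨v, rfl⟩ := (q.comap g).mkQ_surjective v
  exact ⟨v, (Submodule.Quotient.eq q).1 hv⟩

/-! ### General linear forms -/

/-- A general linear combination of some of the variables is a nonzerodivisor modulo `I`, if no
nonzero class modulo `I` is killed by all these variables: by prime avoidance, it lies outside the
finitely many associated primes of `I`. -/
theorem exists_linearForm_regular {σ ι : Type*} [Finite σ] [Fintype ι]
    (I : Ideal (MvPolynomial σ ℂ)) (v : ι → σ) (hI : ∀ f, (∀ j, X (v j) * f ∈ I) → f ∈ I) :
    ∃ c : ι → ℂ, ∀ f, (∑ j, C (c j) * X (v j)) * f ∈ I → f ∈ I := by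
  classical
  let l : (ι → ℂ) →ₗ[ℂ] MvPolynomial σ ℂ :=
    Fintype.linearCombination ℂ fun j => (X (v j) : MvPolynomial σ ℂ)
  have hl : ∀ c, l c = ∑ j, C (c j) * X (v j) := fun c => by
    simp only [l, Fintype.linearCombination_apply, MvPolynomial.smul_eq_C_mul]
  have hfin := associatedPrimes.finite (MvPolynomial σ ℂ) (MvPolynomial σ ℂ ⧸ I)
  let W : Ideal (MvPolynomial σ ℂ) → Submodule ℂ (ι → ℂ) :=
    fun P => (P.restrictScalars ℂ).comap l
  have htop : ⊤ ∉ hfin.toFinset.image W := by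
    simp only [Finset.mem_image, Set.Finite.mem_toFinset, not_exists, not_and]
    intro P hP hW
    obtain ⟨hprime, x, hx⟩ := isAssociatedPrime_iff.1 hP
    obtain ⟨f, rfl⟩ := Ideal.Quotient.mk_surjective x
    have hmem : ∀ r, r ∈ P ↔ r * f ∈ I := fun r => by
      rw [hx, Submodule.mem_colon_singleton, Submodule.mem_bot]
      exact Ideal.Quotient.eq_zero_iff_mem (I := I) (a := r * f)
    have hf : f ∈ I := hI f fun j => by
      rw [← hmem]
      have : Pi.single j 1 ∈ W P := hW ▸ Submodule.mem_top
      simpa [W, l, Fintype.linearCombination_apply_single] using this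
    exact hprime.ne_top ((Ideal.eq_top_iff_one _).2 ((hmem 1).2 (by simpa using hf)))
  obtain ⟨c, hc⟩ := (Set.ne_univ_iff_exists_notMem _).1
    (Subspace.biUnion_ne_univ_of_top_notMem htop)
  refine ⟨c, fun f hf => by_contra fun hfI => hc ?_⟩
  have : l c ∈ {r : MvPolynomial σ ℂ | ∃ x : MvPolynomial σ ℂ ⧸ I, x ≠ 0 ∧ r • x = 0} := by
    refine ⟨Ideal.Quotient.mk I f, by rwa [Ne, Ideal.Quotient.eq_zero_iff_mem], ?_⟩
    rw [hl]
    exact Ideal.Quotient.eq_zero_iff_mem.2 hf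
  rw [← biUnion_associatedPrimes_eq_zero_divisors] at this
  simp only [Set.mem_iUnion] at this ⊢
  obtain ⟨P, hP, hlP⟩ := this
  exact ⟨W P, Finset.mem_image_of_mem _ (hfin.mem_toFinset.2 hP), hlP⟩

theorem mem_of_pow_mul_mem {R : Type*} [CommRing R] {I : Ideal R} {l : R}
    (hl : ∀ f, l * f ∈ I → f ∈ I) (N : ℕ) {f : R} (h : l ^ N * f ∈ I) : f ∈ I := by
  induction N with
  | zero => simpa using h
  | succ N ih => exact ih (hl _ (by rwa [pow_succ', mul_assoc] at h))

/-! ### Forms -/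

instance homogeneousSubmodule_finite {σ : Type*} [Finite σ] (d : ℕ) :
    Module.Finite ℂ (homogeneousSubmodule σ ℂ d) :=
  Module.Finite.iff_fg.2 (homogeneousSubmodule_fg σ ℂ d)

theorem weightedHomogeneousComponent_mul {σ M : Type*} [AddCancelCommMonoid M] (w : σ → M) {r : M}
    {m : MvPolynomial σ ℂ} (hm : m.IsWeightedHomogeneous w r) (u : M) (f : MvPolynomial σ ℂ) :
    weightedHomogeneousComponent w (r + u) (m * f) =
      m * weightedHomogeneousComponent w u f := by
  classical
  rw [← sum_weightedHomogeneousComponent w f]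
  refine finsum_induction (fun f => weightedHomogeneousComponent w (r + u) (m * f) =
      m * weightedHomogeneousComponent w u f) (by simp) ?_ fun v => ?_
  · intro f g hf hg
    rw [mul_add, map_add, map_add, hf, hg, mul_add]
  · have hv := weightedHomogeneousComponent_mem w f v
    rw [weightedHomogeneousComponent_of_mem hv, weightedHomogeneousComponent_of_mem (hm.mul hv)]
    simp only [add_right_inj, mul_ite, mul_zero]

theorem homogeneousComponent_mul {σ : Type*} {r : ℕ} {m : MvPolynomial σ ℂ}
    (hm : m.IsHomogeneous r) (u : ℕ) (f : MvPolynomial σ ℂ) :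
    homogeneousComponent (r + u) (m * f) = m * homogeneousComponent u f :=
  weightedHomogeneousComponent_mul _ hm u f

/-- Multiplication by a form `f` of degree `r`, as a map `S_d → S_{d'}` where `d' = r + d`. -/
def mulForm {σ : Type*} {r d d' : ℕ} (f : MvPolynomial σ ℂ) (hf : f.IsHomogeneous r)
    (h : r + d = d') : homogeneousSubmodule σ ℂ d →ₗ[ℂ] homogeneousSubmodule σ ℂ d' :=
  (LinearMap.mulLeft ℂ f).restrict fun _ hg => h ▸ hf.mul hg

/-! ### Hilbert functions of subschemes of projective space -/

namespace ProjSubscheme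

variable {n : ℕ}

/-- There is a linear form that is a nonzerodivisor modulo the ideal of `A`. -/
theorem exists_regular (A : ProjSubscheme n) : ∃ l : MvPolynomial (Fin (n + 1)) ℂ,
    l.IsHomogeneous 1 ∧ ∀ f, l * f ∈ A.ideal → f ∈ A.ideal := by
  obtain ⟨c, hc⟩ := exists_linearForm_regular A.ideal id fun f hf =>
    A.saturated f fun i => ⟨1, by simpa using hf i⟩
  exact ⟨_, .sum _ _ _ fun j _ => isHomogeneous_C_mul_X _ _, hc⟩

variable (A : ProjSubscheme n) {l : MvPolynomial (Fin (n + 1)) ℂ}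

theorem hilbertFunction_mono : Monotone A.hilbertFunction := by
  obtain ⟨l, hl₁, hl⟩ := A.exists_regular
  intro d d' h
  refine finrank_quotient_le_of_comap_le (mulForm (l ^ (d' - d)) (hl₁.pow _) (by lia)) ?_
  exact fun f hf => mem_of_pow_mul_mem hl _ hf

/-- Where the Hilbert function does not grow, multiplication by a power of a nonzerodivisor `l` is
onto modulo the ideal. -/
theorem exists_pow_mul_sub_mem (hl₁ : l.IsHomogeneous 1) (hl : ∀ f, l * f ∈ A.ideal → f ∈ A.ideal)
    {d N : ℕ} (h : A.hilbertFunction d = A.hilbertFunction (d + N))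
    {g : MvPolynomial (Fin (n + 1)) ℂ} (hg : g.IsHomogeneous (d + N)) :
    ∃ f : MvPolynomial (Fin (n + 1)) ℂ, f.IsHomogeneous d ∧ l ^ N * f - g ∈ A.ideal := by
  let φ := mulForm (l ^ N) (hl₁.pow N) (by lia : 1 * N + d = d + N)
  have hφ : ((A.ideal.restrictScalars ℂ).submoduleOf _).comap φ =
      (A.ideal.restrictScalars ℂ).submoduleOf _ := by
    ext f
    exact ⟨fun hf => mem_of_pow_mul_mem hl N hf, fun hf => A.ideal.mul_mem_left _ hf⟩
  obtain ⟨f, hf⟩ := forall_exists_of_finrank_quotient_eq φ hφ h ⟨g, hg⟩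
  exact ⟨f, f.2, hf⟩

/-- A section of `𝒪(e)` over all charts is a form of degree `e`. -/
theorem exists_form_of_sections {e : ℕ} (F : FractionRing (MvPolynomial (Fin (n + 1)) ℂ))
    (hF : ∀ i, ∃ (N : ℕ) (q : MvPolynomial (Fin (n + 1)) ℂ), q.IsHomogeneous (e + N) ∧
      F * algebraMap _ _ (X i ^ N : MvPolynomial (Fin (n + 1)) ℂ) = algebraMap _ _ q) :
    ∃ f : MvPolynomial (Fin (n + 1)) ℂ, f.IsHomogeneous e ∧ F = algebraMap _ _ f := by
  obtain ⟨N, q, hq, h⟩ := hF 0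
  have hinj := IsFractionRing.injective (MvPolynomial (Fin (n + 1)) ℂ)
    (FractionRing (MvPolynomial (Fin (n + 1)) ℂ))
  have hX : (X 0 ^ N : MvPolynomial (Fin (n + 1)) ℂ) ≠ 0 := pow_ne_zero _ (X_ne_zero _)
  obtain ⟨f, rfl⟩ : (X 0 ^ N : MvPolynomial (Fin (n + 1)) ℂ) ∣ q := by
    rcases n with _ | n
    -- On `ℙ⁰` there is a single chart, and `q` is a multiple of `X 0 ^ (e + N)`.
    · rw [q.as_sum]
      refine Finset.dvd_sum fun d hd => ?_
      rw [X_pow_eq_monomial, monomial_dvd_monomial]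
      refine ⟨Or.inr ?_, one_dvd _⟩
      have := hq.degree_eq_sum_deg_support hd
      rw [Finset.sum_subset (Finset.subset_univ _) (by simp)] at this
      simpa [Finsupp.single_le_iff] using le_of_add_le_right (a := e) (by simpa using this.le)
    · obtain ⟨N', q', -, h'⟩ := hF 1
      refine (X_prime (R := ℂ) (i := (0 : Fin (n + 2)))).pow_dvd_of_dvd_mul_left N
        (a := X 1 ^ N') (fun hd => ?_) ⟨q', hinj ?_⟩
      · have := (X_dvd_X (R := ℂ)).1 (X_prime.dvd_of_dvd_pow hd)
        simp at this
      · rw [map_mul, map_mul, ← h, ← h']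
        ring
  refine ⟨f, ?_, ?_⟩
  · intro d hd
    have := hq (d := Finsupp.single 0 N + d) (by
      rwa [X_pow_eq_monomial, coeff_monomial_mul, one_mul])
    simp only [map_add, Finsupp.weight_single, Pi.one_apply, smul_eq_mul, mul_one] at this
    lia
  · have : algebraMap _ (FractionRing (MvPolynomial (Fin (n + 1)) ℂ)) (X 0 ^ N :
      MvPolynomial (Fin (n + 1)) ℂ) ≠ 0 := by simp
    rw [map_mul, mul_comm] at h
    exact mul_left_cancel₀ this h

/-- If `h¹(𝒥_A(e)) = 0`, then `S_e → H⁰(𝒪_A(e))` is onto, so that the Hilbert function has its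
final value already in degree `e`. An element of `H⁰(𝒪_A(e))` is written as `g / l ^ N`, where the
linear form `l` has no zero on `A`. It has local lifts `h i / X i ^ N`, whose differences form a
cocycle of `𝒥_A(e)`; a coboundary corrects them to a global form of degree `e`. -/
theorem hilbertFunction_eq_of_h1_eq_zero {e r : ℕ} (hA : A.HasDegree r) (h1 : A.h1 e = 0) {d : ℕ}
    (hd : e ≤ d) : A.hilbertFunction d = r := by
  obtain ⟨N, hN⟩ := hA
  suffices h : r ≤ A.hilbertFunction e by
    refine le_antisymm ?_ (h.trans (A.hilbertFunction_mono hd))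
    rw [← hN (max d N) (le_max_right _ _)]
    exact A.hilbertFunction_mono (le_max_left _ _)
  rw [← hN (e + N) (by lia)]
  obtain ⟨l, hl₁, hl⟩ := A.exists_regular
  let K := FractionRing (MvPolynomial (Fin (n + 1)) ℂ)
  let ι : MvPolynomial (Fin (n + 1)) ℂ →+* K := algebraMap _ _
  have hι : Function.Injective ι := IsFractionRing.injective _ K
  have hX : ∀ i (M : ℕ), ι (X i) ^ M ≠ 0 := fun i M =>
    pow_ne_zero _ ((map_ne_zero_iff ι hι).2 (X_ne_zero i))
  refine finrank_quotient_le_of_forall_exists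
    (mulForm (l ^ N) (hl₁.pow N) (by lia : 1 * N + e = e + N))
    (fun f hf => A.ideal.mul_mem_left _ hf) ?_
  rintro ⟨g, hg⟩
  -- `l ^ N` is onto modulo `I_A` from degree `e + N` on, so that
  -- `X i ^ N * g` is a multiple of `l ^ N` modulo `I_A`.
  have hloc : ∀ i, ∃ h : MvPolynomial (Fin (n + 1)) ℂ, h.IsHomogeneous (e + N) ∧
      l ^ N * h - X i ^ N * g ∈ A.ideal := fun i =>
    A.exists_pow_mul_sub_mem hl₁ hl (by rw [hN _ (by lia), hN _ (by lia)])
      (by simpa [add_comm] using (isHomogeneous_X_pow i N).mul hg)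
  choose h hh hhg using hloc
  let s : Fin (n + 1) → K := fun i => ι (h i) / ι (X i) ^ N
  have hs' : ∀ i, s i * ι (X i) ^ N = ι (h i) := fun i => div_mul_cancel₀ _ (hX i N)
  have hs : (fun i j => s j - s i) ∈ A.cechCocycles e := by
    refine ⟨fun i j => ⟨N, X i ^ N * h j - X j ^ N * h i, ?_, ?_, ?_⟩, fun i j k => by ring⟩
    · refine mem_of_pow_mul_mem hl N ?_
      have := A.ideal.sub_mem (A.ideal.mul_mem_left (X i ^ N) (hhg j))
        (A.ideal.mul_mem_left (X j ^ N) (hhg i))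
      convert this using 1
      ring
    · have key : ∀ i j, (X i ^ N * h j).IsHomogeneous (e + N * Multiset.card {i, j}) := by
        intro i j
        convert (isHomogeneous_X_pow i N).mul (hh j) using 1
        rw [Multiset.card_pair]
        ring
      exact (key i j).sub (by simpa [Multiset.card_pair] using key j i)
    · have hi := hs' i
      have hj := hs' j
      change (s j - s i) * ι _ = ι _
      simp only [Multiset.insert_eq_cons, Multiset.map_cons, Multiset.map_singleton,
        Multiset.prod_cons, Multiset.prod_singleton, map_pow, map_mul, map_sub, mul_pow]
      linear_combination ι (X i) ^ N * hj - ι (X j) ^ N * hi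
  have hsub : Subsingleton (A.H1 e) := rank_zero_iff.1 h1
  obtain ⟨t, ht, hst⟩ : (fun i j => s j - s i) ∈ A.cechCoboundaries e := by
    have := (Submodule.Quotient.mk_eq_zero
      ((A.cechCoboundaries e).submoduleOf (A.cechCocycles e))).1
      (Subsingleton.elim (Submodule.Quotient.mk ⟨_, hs⟩ : A.H1 e) 0)
    exact this
  choose M p hpI hp hpt using ht
  simp only [Multiset.map_singleton, Multiset.prod_singleton, Multiset.card_singleton,
    mul_one] at hp hpt
  -- The corrected local lifts `s i - t i` agree, and `q i` is the numerator over `X i ^ (M i + N)`.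
  let q : Fin (n + 1) → MvPolynomial (Fin (n + 1)) ℂ := fun i => X i ^ M i * h i - X i ^ N * p i
  have hq : ∀ i, (s 0 - t 0) * ι (X i ^ (M i + N)) = ι (q i) := by
    intro i
    have h0 : s 0 - t 0 = s i - t i := by linear_combination -hst 0 i
    have hpt' : t i * ι (X i) ^ M i = ι (p i) := by simpa [ι] using hpt i
    rw [h0]
    simp only [q, map_sub, map_mul, map_pow]
    linear_combination ι (X i) ^ M i * hs' i - ι (X i) ^ N * hpt'
  obtain ⟨f, hf, hsf⟩ := exists_form_of_sections (e := e) (s 0 - t 0) fun i => ⟨M i + N, q i, by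
    refine IsHomogeneous.sub ?_ ?_
    · have := (isHomogeneous_X_pow i (M i)).mul (hh i)
      rwa [add_left_comm] at this
    · have := (isHomogeneous_X_pow i N).mul (hp i)
      rwa [add_left_comm, add_comm N] at this, hq i⟩
  refine ⟨⟨f, hf⟩, A.saturated _ fun i => ⟨M i + N, ?_⟩⟩
  have hfq : f * X i ^ (M i + N) = q i := hι (by
    rw [map_mul, ← hq i, hsf])
  have := A.ideal.sub_mem (A.ideal.mul_mem_left (X i ^ M i) (hhg i))
    (A.ideal.mul_mem_left (l ^ N * X i ^ N) (hpI i))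
  convert this using 1
  change X i ^ (M i + N) * (l ^ N * f - g) = _
  simp only [q] at hfq
  linear_combination l ^ N * hfq

end ProjSubscheme

/-! ### Multilinear forms and flattenings -/

variable {n : ℕ}

/-- The form `∑ₐ c(a) ∏ᵢ x_{v i (a i)}`, where `v i j` is the variable used for the `j`-th
coordinate of the `i`-th factor. For `v i j = (i, j)` it is the multilinear form on `(ℙⁿ)ᵏ` with
coefficients `c`, and for `v i j = j` it is the restriction of that form to the diagonal. -/
def multilinearForm {σ : Type*} {k : ℕ} (v : Fin k → Fin (n + 1) → σ) :
    ((Fin k → Fin (n + 1)) → ℂ) →ₗ[ℂ] MvPolynomial σ ℂ :=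
  Fintype.linearCombination ℂ fun a => ∏ i, X (v i (a i))

theorem multilinearForm_apply {σ : Type*} {k : ℕ} (v : Fin k → Fin (n + 1) → σ)
    (c : (Fin k → Fin (n + 1)) → ℂ) :
    multilinearForm v c = ∑ a, C (c a) * ∏ i, X (v i (a i)) := by
  simp only [multilinearForm, Fintype.linearCombination_apply, MvPolynomial.smul_eq_C_mul]

theorem segrePullback_eq {k : ℕ} (L : Dual ℂ (Tensor k n)) :
    segrePullback L = multilinearForm Prod.mk fun a => L (basisTensor a) := by
  rw [multilinearForm_apply]
  rfl

theorem veronesePullback_eq {k : ℕ} (L : Dual ℂ (Tensor k n)) :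
    veronesePullback L = multilinearForm (fun _ => id) fun a => L (basisTensor a) := by
  rw [multilinearForm_apply]
  rfl

theorem rename_multilinearForm {σ τ : Type*} {k : ℕ} (g : σ → τ) (v : Fin k → Fin (n + 1) → σ)
    (c : (Fin k → Fin (n + 1)) → ℂ) :
    rename g (multilinearForm v c) = multilinearForm (fun i j => g (v i j)) c := by
  simp [multilinearForm_apply]

/-- The coefficients of the product of a multilinear form on the first `e` factors and one on the
last `e'` factors. -/
def mulCoeff {e e' : ℕ} (α : (Fin e → Fin (n + 1)) → ℂ) (β : (Fin e' → Fin (n + 1)) → ℂ)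
    (a : Fin (e + e') → Fin (n + 1)) : ℂ :=
  α (fun i => a (Fin.castAdd e' i)) * β (fun i => a (Fin.natAdd e i))

theorem multilinearForm_mulCoeff {σ : Type*} {e e' : ℕ} (v : Fin (e + e') → Fin (n + 1) → σ)
    (α : (Fin e → Fin (n + 1)) → ℂ) (β : (Fin e' → Fin (n + 1)) → ℂ) :
    multilinearForm v (mulCoeff α β) = multilinearForm (fun i => v (Fin.castAdd e' i)) α *
      multilinearForm (fun i => v (Fin.natAdd e i)) β := by
  simp only [multilinearForm_apply, Finset.sum_mul_sum]
  rw [← Fintype.sum_prod_type', ← (Fin.appendEquiv e e').sum_comp]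
  refine Finset.sum_congr rfl fun x _ => ?_
  simp only [mulCoeff, Fin.appendEquiv, Equiv.coe_fn_mk, Fin.append_left, Fin.append_right,
    Fin.prod_univ_add, map_mul]
  ring

theorem multilinearForm_isWeightedHomogeneous {σ M : Type*} [AddCommMonoid M] {k : ℕ}
    (v : Fin k → Fin (n + 1) → σ) (c : (Fin k → Fin (n + 1)) → ℂ) (w : σ → M) (m : Fin k → M)
    (h : ∀ i j, w (v i j) = m i) : (multilinearForm v c).IsWeightedHomogeneous w (∑ i, m i) := by
  rw [multilinearForm_apply]
  refine .sum _ _ _ fun a _ => (IsWeightedHomogeneous.prod _ _ _ fun i _ => ?_).C_mul _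
  rw [← h i (a i)]
  exact isWeightedHomogeneous_X _ _ _

theorem multilinearForm_isHomogeneous {σ : Type*} {k : ℕ} (v : Fin k → Fin (n + 1) → σ)
    (c : (Fin k → Fin (n + 1)) → ℂ) : (multilinearForm v c).IsHomogeneous k := by
  have := multilinearForm_isWeightedHomogeneous v c (1 : σ → ℕ) (fun _ => 1) fun _ _ => rfl
  rw [Finset.sum_const, Finset.card_univ, Fintype.card_fin, smul_eq_mul, mul_one] at this
  exact this

/-- Every form of degree `k` on `ℙⁿ` is the restriction of a multilinear form to the diagonal. -/
theorem exists_multilinearForm_eq {k : ℕ} {f : MvPolynomial (Fin (n + 1)) ℂ}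
    (hf : f.IsHomogeneous k) : ∃ c, multilinearForm (fun _ : Fin k => id) c = f := by
  change f ∈ LinearMap.range _
  rw [f.as_sum]
  refine Submodule.sum_mem _ fun d hd => ?_
  have hd : (Finsupp.toMultiset d).card = k := by
    rw [hf.degree_eq_sum_deg_support hd, Finsupp.card_toMultiset]; rfl
  obtain ⟨s, hs⟩ := Quot.exists_rep (Finsupp.toMultiset d)
  have hs : (s : Multiset (Fin (n + 1))) = Finsupp.toMultiset d := hs
  have hlen : s.length = k := by rw [← hd, ← hs]; rfl
  subst hlen
  refine ⟨Pi.single s.get (coeff d f), ?_⟩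
  rw [multilinearForm, Fintype.linearCombination_apply_single, monomial_eq,
    MvPolynomial.smul_eq_C_mul]
  congr 1
  have : (d.toMultiset.map X).prod = d.prod fun i r => (X i : MvPolynomial (Fin (n + 1)) ℂ) ^ r := by
    rw [Finsupp.toMultiset_map, Finsupp.prod_toMultiset,
      Finsupp.prod_mapDomain_index (by simp) (by simp [pow_add])]
  rw [← this, ← hs, Multiset.map_coe, Multiset.prod_coe]
  conv_rhs => rw [← List.ofFn_get s, List.map_ofFn, List.prod_ofFn]
  rfl

/-! ### Coordinates of tensors -/

/-- The basis of the space of tensors that consists of the `basisTensor a`. -/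
def tensorBasis (k n : ℕ) : Basis (Fin k → Fin (n + 1)) ℂ (Tensor k n) :=
  Basis.piTensorProduct fun _ => Pi.basisFun ℂ (Fin (n + 1))

theorem tensorBasis_apply {k : ℕ} (a : Fin k → Fin (n + 1)) :
    tensorBasis k n a = basisTensor a := by
  simp [tensorBasis, basisTensor]

/-- A linear form on tensors is given by arbitrary values on the `basisTensor a`. -/
theorem exists_dual_eq {k : ℕ} (c : (Fin k → Fin (n + 1)) → ℂ) :
    ∃ L : Dual ℂ (Tensor k n), (fun a => L (basisTensor a)) = c :=
  ⟨(tensorBasis k n).constr ℂ c, funext fun a => by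
    rw [← tensorBasis_apply, Basis.constr_basis]⟩

theorem dual_segrePoint {k : ℕ} (L : Dual ℂ (Tensor k n)) (p : Fin k → ℙ ℂ (Fin (n + 1) → ℂ)) :
    L (segrePoint p) = eval (fun x => (p x.1).rep x.2) (segrePullback L) := by
  rw [← (tensorBasis k n).sum_repr (segrePoint p), segrePullback]
  simp [tensorBasis, segrePoint, basisTensor, mul_comm]

/-! ### Nondegeneracy of the flattening -/

namespace ProjSubscheme

theorem mem_veroneseSpan {A : ProjSubscheme n} {k : ℕ} {t : Tensor k n} :
    t ∈ A.veroneseSpan k ↔ ∀ L : Dual ℂ (Tensor k n), veronesePullback L ∈ A.ideal → L t = 0 := by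
  simp [veroneseSpan, Submodule.mem_iInf]

/-- The saturation of `I_A + (f)` with respect to `l`. -/
def cutIdeal (A : ProjSubscheme n) (l f : MvPolynomial (Fin (n + 1)) ℂ) :
    Ideal (MvPolynomial (Fin (n + 1)) ℂ) where
  carrier := {g | ∃ N h, l ^ N * g - f * h ∈ A.ideal}
  zero_mem' := ⟨0, 0, by simp⟩
  add_mem' := by
    rintro g g' ⟨N, h, H⟩ ⟨N', h', H'⟩
    refine ⟨N + N', l ^ N' * h + l ^ N * h', ?_⟩
    convert A.ideal.add_mem (A.ideal.mul_mem_left (l ^ N') H) (A.ideal.mul_mem_left (l ^ N) H')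
      using 1
    ring
  smul_mem' := by
    rintro c g ⟨N, h, H⟩
    refine ⟨N, c * h, ?_⟩
    convert A.ideal.mul_mem_left c H using 1
    rw [smul_eq_mul]
    ring

/-- The subscheme of `A` cut out by a form `f`, where `l` is a linear form. (If `l` has no zeros
on `A`, then saturation with respect to `l` is saturation with respect to the irrelevant ideal.) -/
def cut (A : ProjSubscheme n) (l f : MvPolynomial (Fin (n + 1)) ℂ) (hl : l.IsHomogeneous 1)
    {e : ℕ} (hf : f.IsHomogeneous e) : ProjSubscheme n where
  ideal := A.cutIdeal l f
  homogeneous := by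
    rintro g ⟨N, h, H⟩ d
    refine ⟨e + N, homogeneousComponent (N + d) (l ^ e * h), ?_⟩
    have h1 := A.homogeneous _ (A.ideal.mul_mem_left (l ^ e) H) (e + N + d)
    have h2 : l ^ e * (l ^ N * g - f * h) = l ^ (e + N) * g - f * (l ^ e * h) := by ring
    have h3 := homogeneousComponent_mul (hl.pow (e + N)) d g
    rw [one_mul] at h3
    rwa [h2, map_sub, h3, add_assoc, homogeneousComponent_mul hf] at h1
  saturated := by
    intro g hg
    have hlg : l ∈ ((A.cutIdeal l f).colon {g}).radical := by
      have : l ∈ homogeneousSubmodule (Fin (n + 1)) ℂ 1 := hl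
      rw [homogeneousSubmodule_one_eq_span_X] at this
      have hle : Submodule.span ℂ (Set.range X) ≤
          ((A.cutIdeal l f).colon {g}).radical.restrictScalars ℂ := by
        rw [Submodule.span_le]
        rintro _ ⟨i, rfl⟩
        obtain ⟨N, hN⟩ := hg i
        exact ⟨N, Submodule.mem_colon_singleton.2 hN⟩
      exact hle this
    obtain ⟨M, hM⟩ := hlg
    obtain ⟨N, h, H⟩ := Submodule.mem_colon_singleton.1 hM
    exact ⟨N + M, h, by rwa [pow_add, mul_assoc]⟩

/-- Nondegeneracy of the flattening. If the form `f` with coefficients `α` is orthogonal to all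
forms of complementary degree, then `t` lies in the span of the subscheme of `A` cut out by `f`, so
minimality of `A` forces `f` to vanish on `A`. The point is that the ideal `I_A + (f)` is already
saturated in degree `e + e'`, because multiplication by a power of `l` is an isomorphism of `S / I_A`
from degree `e'` on. -/
theorem multilinearForm_mem_of_orthogonal {A : ProjSubscheme n} {e e' r : ℕ}
    (hA : ∀ d, e' ≤ d → A.hilbertFunction d = r) {t : Tensor (e + e') n}
    (ht : t ∈ A.veroneseSpan (e + e'))
    (hmin : ∀ A' : ProjSubscheme n, A'.IsProperSubscheme A → t ∉ A'.veroneseSpan (e + e'))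
    {α : (Fin e → Fin (n + 1)) → ℂ}
    (hα : ∀ (β : (Fin e' → Fin (n + 1)) → ℂ) (L : Dual ℂ (Tensor (e + e') n)),
      (fun a => L (basisTensor a)) = mulCoeff α β → L t = 0) :
    multilinearForm (fun _ => id) α ∈ A.ideal := by
  by_contra hf
  obtain ⟨l, hl₁, hl⟩ := A.exists_regular
  have hfe := multilinearForm_isHomogeneous (fun _ : Fin e => id) α
  refine hmin (A.cut l _ hl₁ hfe) (lt_of_le_of_ne ?_ fun heq => hf ?_) ?_
  · exact fun g hg => ⟨0, 0, by simpa using hg⟩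
  · rw [heq]
    exact ⟨0, 1, by simp⟩
  · refine mem_veroneseSpan.2 fun L hL => ?_
    -- `t` is annihilated by `L`, as `veronesePullback L` is congruent to `f` times a form of
    -- degree `e'` modulo `I_A`.
    set f := multilinearForm (fun _ : Fin e => id) α with hfdef
    obtain ⟨N, h, H⟩ : ∃ N h, l ^ N * veronesePullback L - f * h ∈ A.ideal := hL
    have hQ : (veronesePullback L).IsHomogeneous (e + e') := by
      rw [veronesePullback_eq]
      exact multilinearForm_isHomogeneous _ _
    have H1 := A.homogeneous _ H (e + (e' + N))
    have h2 : (l ^ N * veronesePullback L).IsHomogeneous (e + (e' + N)) := by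
      have := (hl₁.pow N).mul hQ
      rwa [one_mul, show N + (e + e') = e + (e' + N) by ring] at this
    rw [map_sub, homogeneousComponent_eq_self h2, homogeneousComponent_mul hfe] at H1
    obtain ⟨g, hg, hgh⟩ := A.exists_pow_mul_sub_mem hl₁ hl (d := e') (N := N)
      (by rw [hA _ le_rfl, hA _ (by lia)]) (homogeneousComponent_isHomogeneous (e' + N) h)
    obtain ⟨β, rfl⟩ := exists_multilinearForm_eq hg
    obtain ⟨L', hL'⟩ := exists_dual_eq (mulCoeff α β)
    have hL'Q : veronesePullback L' = f * multilinearForm (fun _ => id) β := by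
      rw [veronesePullback_eq, hL', multilinearForm_mulCoeff]
    have hsub : veronesePullback (L - L') = veronesePullback L - veronesePullback L' := by
      simp only [veronesePullback_eq, ← map_sub]
      rfl
    have hmem : veronesePullback (L - L') ∈ A.ideal := by
      rw [hsub, hL'Q]
      refine mem_of_pow_mul_mem hl N ?_
      convert A.ideal.sub_mem H1 (A.ideal.mul_mem_left f hgh) using 1
      ring
    have h0 := mem_veroneseSpan.1 ht _ hmem
    rw [LinearMap.sub_apply, hα β L' hL', sub_zero] at h0
    exact h0

/-- The vectors `α` that are orthogonal to all `β` form a space of codimension at least the degree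
of `A`. -/
theorem le_finrank_quotient {A : ProjSubscheme n} {e e' r : ℕ} (he : e ≤ e')
    (hA : ∀ d, e ≤ d → A.hilbertFunction d = r) {t : Tensor (e + e') n}
    (ht : t ∈ A.veroneseSpan (e + e'))
    (hmin : ∀ A' : ProjSubscheme n, A'.IsProperSubscheme A → t ∉ A'.veroneseSpan (e + e'))
    {p : Submodule ℂ ((Fin e → Fin (n + 1)) → ℂ)}
    (hp : ∀ α ∈ p, ∀ (β : (Fin e' → Fin (n + 1)) → ℂ) (L : Dual ℂ (Tensor (e + e') n)),
      (fun a => L (basisTensor a)) = mulCoeff α β → L t = 0) :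
    r ≤ finrank ℂ (((Fin e → Fin (n + 1)) → ℂ) ⧸ p) := by
  rw [← hA e le_rfl]
  refine finrank_quotient_le_of_forall_exists
    ((multilinearForm fun _ => id).codRestrict (homogeneousSubmodule (Fin (n + 1)) ℂ e)
      fun α => (mem_homogeneousSubmodule _ _).2 (multilinearForm_isHomogeneous _ α))
    (fun α hα => multilinearForm_mem_of_orthogonal (fun d hd => hA d (he.trans hd)) ht hmin
      (hp α hα)) fun f => ?_
  obtain ⟨α, hα⟩ := exists_multilinearForm_eq f.2
  refine ⟨α, ?_⟩
  convert Submodule.zero_mem _ using 1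
  exact sub_eq_zero.2 (Subtype.ext hα)

end ProjSubscheme

/-! ### Subschemes of products of projective spaces -/

theorem multiForms_le_homogeneousSubmodule {k : ℕ} (u : Fin k → ℕ) :
    multiForms k n u ≤ homogeneousSubmodule (Fin k × Fin (n + 1)) ℂ (∑ i, u i) := by
  intro F hF d hd
  rw [← hF hd]
  simp only [Finsupp.weight_apply, Finsupp.sum, Finset.sum_apply, Pi.smul_apply, multiWeight]
  rw [Finset.sum_comm]
  simp [← Finset.mul_sum]

instance multiForms_finite {k : ℕ} (u : Fin k → ℕ) : Module.Finite ℂ (multiForms k n u) :=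
  Submodule.finiteDimensional_of_le (multiForms_le_homogeneousSubmodule u)

namespace MultiProjSubscheme

variable {k : ℕ} (Z : MultiProjSubscheme k n)

theorem mem_segreSpan {Z : MultiProjSubscheme k n} {t : Tensor k n} :
    t ∈ Z.segreSpan ↔ ∀ L : Dual ℂ (Tensor k n), segrePullback L ∈ Z.ideal → L t = 0 := by
  simp [segreSpan, Submodule.mem_iInf]

/-- There is a linear form on the `i`-th factor that is a nonzerodivisor modulo the ideal of `Z`. -/
theorem exists_regular (i : Fin k) : ∃ l : MvPolynomial (Fin k × Fin (n + 1)) ℂ,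
    l.IsWeightedHomogeneous (multiWeight k n) (Pi.single i 1) ∧
      ∀ f, l * f ∈ Z.ideal → f ∈ Z.ideal := by
  obtain ⟨c, hc⟩ := exists_linearForm_regular Z.ideal (Prod.mk i) fun f hf =>
    Z.saturated f fun j => ⟨1, by
      rw [pow_one, Finset.prod_eq_mul_prod_sdiff_singleton_of_mem (Finset.mem_univ i), mul_right_comm]
      exact Z.ideal.mul_mem_right _ (hf (j i))⟩
  exact ⟨_, .sum _ _ _ fun j _ => (isWeightedHomogeneous_X _ _ _).C_mul _, hc⟩

theorem hilbertFunction_mono : Monotone Z.hilbertFunction := by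
  intro u u' h
  choose l hl₁ hl using Z.exists_regular
  have hw : (∏ i, l i ^ (u' i - u i)).IsWeightedHomogeneous (multiWeight k n) (u' - u) := by
    have := IsWeightedHomogeneous.prod Finset.univ _ _ fun i _ => (hl₁ i).pow (u' i - u i)
    convert this using 1
    ext i
    simp [Finset.sum_apply, Pi.single_apply]
  have hreg : ∀ s : Finset (Fin k), ∀ f,
      (∏ i ∈ s, l i ^ (u' i - u i)) * f ∈ Z.ideal → f ∈ Z.ideal := by
    intro s
    induction s using Finset.cons_induction with
    | empty => simp
    | cons i s hi ih =>
      intro f hf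
      rw [Finset.prod_cons, mul_assoc] at hf
      exact ih f (mem_of_pow_mul_mem (hl i) _ hf)
  refine finrank_quotient_le_of_comap_le ((LinearMap.mulLeft ℂ _).restrict fun f hf => ?_)
    fun f hf => hreg Finset.univ f hf
  have := hw.mul hf
  rwa [tsub_add_cancel_of_le h] at this

/-- The lower bound for the cactus rank, where `r` is the degree of `A` and `t` represents `T`: a
multilinear form on the first `e` factors that vanishes on `Z` is orthogonal to all multilinear
forms on the remaining factors. -/
theorem le_hilbertFunction {A : ProjSubscheme n} {e e' r : ℕ} (he : e ≤ e')
    (hA : ∀ d, e ≤ d → A.hilbertFunction d = r) {t : Tensor (e + e') n}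
    (ht : t ∈ A.veroneseSpan (e + e'))
    (hmin : ∀ A' : ProjSubscheme n, A'.IsProperSubscheme A → t ∉ A'.veroneseSpan (e + e'))
    {Z : MultiProjSubscheme (e + e') n} (hZ : t ∈ Z.segreSpan) {u : Fin (e + e') → ℕ}
    (hu : ∀ i, 1 ≤ u i) : r ≤ Z.hilbertFunction u := by
  -- `u₀` is the multidegree of the multilinear forms on the first `e` factors.
  let u₀ : Fin (e + e') → ℕ := ∑ i : Fin e, Pi.single (Fin.castAdd e' i) 1
  have hu₀ : u₀ ≤ u := by
    refine le_trans (b := fun _ => 1) ?_ hu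
    intro j
    simp only [u₀, Finset.sum_apply, Pi.single_apply]
    rw [Finset.sum_boole]
    refine Nat.cast_le_one.2 (Finset.card_le_one.2 fun a ha b hb => ?_)
    simp only [Finset.mem_filter, Finset.mem_univ, true_and] at ha hb
    exact Fin.castAdd_injective _ _ (ha.symm.trans hb)
  refine le_trans ?_ (Z.hilbertFunction_mono hu₀)
  let v : Fin e → Fin (n + 1) → Fin (e + e') × Fin (n + 1) := fun i => Prod.mk (Fin.castAdd e' i)
  refine (ProjSubscheme.le_finrank_quotient he hA ht hmin
    (p := (Z.ideal.restrictScalars ℂ).comap (multilinearForm v)) fun α hα β L hL => ?_).trans ?_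
  · refine mem_segreSpan.1 hZ L ?_
    rw [segrePullback_eq, hL, multilinearForm_mulCoeff]
    exact Z.ideal.mul_mem_right _ hα
  · exact finrank_quotient_le_of_comap_le
      ((multilinearForm v).codRestrict (multiForms (e + e') n u₀) fun α =>
        multilinearForm_isWeightedHomogeneous v α _ _ fun _ _ => rfl) fun α hα => hα

end MultiProjSubscheme

namespace ProjSubscheme

/-- The multihomogeneous ideal of the image of `A` in the diagonal of `(ℙⁿ)ᵏ`: a multihomogeneous
form vanishes on it if its restriction to the diagonal vanishes on `A`. -/
def diagonalIdeal (A : ProjSubscheme n) (k : ℕ) :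
    Ideal (MvPolynomial (Fin k × Fin (n + 1)) ℂ) where
  carrier := {F | ∀ u, rename Prod.snd (weightedHomogeneousComponent (multiWeight k n) u F) ∈
    A.ideal}
  zero_mem' u := by simp
  add_mem' hF hG u := by
    rw [map_add, map_add]
    exact A.ideal.add_mem (hF u) (hG u)
  smul_mem' c F hF := by
    classical
    intro u
    rw [smul_eq_mul, ← sum_weightedHomogeneousComponent (multiWeight k n) c]
    refine finsum_induction (fun c => rename Prod.snd
      (weightedHomogeneousComponent (multiWeight k n) u (c * F)) ∈ A.ideal) (by simp) ?_ fun v => ?_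
    · intro c c' hc hc'
      rw [add_mul, map_add, map_add]
      exact A.ideal.add_mem hc hc'
    have key : ∀ w, rename Prod.snd (weightedHomogeneousComponent (multiWeight k n) u
        (weightedHomogeneousComponent (multiWeight k n) v c *
          weightedHomogeneousComponent (multiWeight k n) w F)) ∈ A.ideal := by
      intro w
      rw [weightedHomogeneousComponent_of_mem ((weightedHomogeneousComponent_mem _ c v).mul
        (weightedHomogeneousComponent_mem _ F w))]
      split_ifs
      · rw [map_mul]
        exact A.ideal.mul_mem_left _ (hF w)
      · simp
    rw [← sum_weightedHomogeneousComponent (multiWeight k n) F]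
    refine finsum_induction (fun F => rename Prod.snd (weightedHomogeneousComponent
      (multiWeight k n) u (weightedHomogeneousComponent (multiWeight k n) v c * F)) ∈ A.ideal)
      (by simp) ?_ key
    intro F F' hF hF'
    rw [mul_add, map_add, map_add]
    exact A.ideal.add_mem hF hF'

theorem mem_diagonalIdeal {A : ProjSubscheme n} {k : ℕ} {u : Fin k → ℕ}
    {F : MvPolynomial (Fin k × Fin (n + 1)) ℂ}
    (hF : F.IsWeightedHomogeneous (multiWeight k n) u) :
    F ∈ A.diagonalIdeal k ↔ rename Prod.snd F ∈ A.ideal := by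
  classical
  refine ⟨fun h => ?_, fun h v => ?_⟩
  · have := h u
    rwa [weightedHomogeneousComponent_eq_self hF] at this
  · rw [weightedHomogeneousComponent_of_mem hF]
    split_ifs
    · exact h
    · simp

/-- The image of `A` in the diagonal of `(ℙⁿ)ᵏ`. -/
def diagonal (A : ProjSubscheme n) (k : ℕ) : MultiProjSubscheme k n where
  ideal := A.diagonalIdeal k
  homogeneous F hF u :=
    (mem_diagonalIdeal (weightedHomogeneousComponent_isWeightedHomogeneous u F)).2 (hF u)
  saturated := by
    intro F hF u
    refine A.saturated _ fun i => ?_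
    obtain ⟨N, hN⟩ := hF fun _ => i
    have hm := (IsWeightedHomogeneous.prod Finset.univ _ _ fun (l : Fin k) _ =>
      isWeightedHomogeneous_X ℂ (multiWeight k n) (l, i)).pow N
    have := hN (N • (∑ l : Fin k, multiWeight k n (l, i)) + u)
    rw [weightedHomogeneousComponent_mul _ hm] at this
    refine ⟨k * N, ?_⟩
    simpa [pow_mul] using this

theorem diagonal_hilbertFunction_le (A : ProjSubscheme n) {k : ℕ} (u : Fin k → ℕ) :
    (A.diagonal k).hilbertFunction u ≤ A.hilbertFunction (∑ i, u i) := by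
  let δ : MvPolynomial (Fin k × Fin (n + 1)) ℂ →ₗ[ℂ] MvPolynomial (Fin (n + 1)) ℂ :=
    (rename Prod.snd).toLinearMap
  have hδ : ∀ F ∈ multiForms k n u, δ F ∈ homogeneousSubmodule (Fin (n + 1)) ℂ (∑ i, u i) :=
    fun F hF => IsHomogeneous.rename_isHomogeneous (multiForms_le_homogeneousSubmodule u hF)
  exact finrank_quotient_le_of_comap_le (δ.restrict hδ) fun F hF => (mem_diagonalIdeal F.2).2 hF

theorem veroneseSpan_le_diagonal_segreSpan (A : ProjSubscheme n) (k : ℕ) :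
    A.veroneseSpan k ≤ (A.diagonal k).segreSpan := by
  intro t ht
  refine MultiProjSubscheme.mem_segreSpan.2 fun L hL => mem_veroneseSpan.1 ht L ?_
  have hhom : (segrePullback L).IsWeightedHomogeneous (multiWeight k n)
      (∑ i, Pi.single i 1) := by
    rw [segrePullback_eq]
    exact multilinearForm_isWeightedHomogeneous _ _ _ _ fun _ _ => rfl
  have hL' := (mem_diagonalIdeal hhom).1 hL
  rw [segrePullback_eq, rename_multilinearForm] at hL'
  rw [veronesePullback_eq]
  exact hL'

/-! ### Finite sets of points -/

/-- The lower bound for the rank: a multilinear form on the first `e` factors that vanishes at the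
points of `S` is orthogonal to all multilinear forms on the remaining factors. -/
theorem le_card_of_mem_span {A : ProjSubscheme n} {e e' r : ℕ} (he : e ≤ e')
    (hA : ∀ d, e ≤ d → A.hilbertFunction d = r) {t : Tensor (e + e') n}
    (ht : t ∈ A.veroneseSpan (e + e'))
    (hmin : ∀ A' : ProjSubscheme n, A'.IsProperSubscheme A → t ∉ A'.veroneseSpan (e + e'))
    {S : Finset (Fin (e + e') → ℙ ℂ (Fin (n + 1) → ℂ))}
    (hS : t ∈ Submodule.span ℂ (segrePoint '' (S : Set (Fin (e + e') → ℙ ℂ (Fin (n + 1) → ℂ))))) :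
    r ≤ S.card := by
  let v : Fin e → Fin (n + 1) → Fin (e + e') × Fin (n + 1) := fun i => Prod.mk (Fin.castAdd e' i)
  let ev : ((Fin e → Fin (n + 1)) → ℂ) →ₗ[ℂ] S → ℂ := LinearMap.pi fun p =>
    (aeval fun x => (p.1 x.1).rep x.2 :
      MvPolynomial (Fin (e + e') × Fin (n + 1)) ℂ →ₐ[ℂ] ℂ).toLinearMap ∘ₗ multilinearForm v
  calc r ≤ finrank ℂ (((Fin e → Fin (n + 1)) → ℂ) ⧸ (⊥ : Submodule ℂ (S → ℂ)).comap ev) :=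
        le_finrank_quotient he hA ht hmin fun α hα β L hL => ?_
    _ ≤ finrank ℂ ((S → ℂ) ⧸ (⊥ : Submodule ℂ (S → ℂ))) :=
        finrank_quotient_le_of_comap_le ev le_rfl
    _ ≤ finrank ℂ (S → ℂ) := Submodule.finrank_quotient_le _
    _ = S.card := by simp
  have hle : Submodule.span ℂ (segrePoint '' (S : Set _)) ≤ LinearMap.ker L := by
    rw [Submodule.span_le]
    rintro _ ⟨p, hp, rfl⟩
    have h0 : eval (fun x => (p x.1).rep x.2) (multilinearForm v α) = 0 := congrFun hα ⟨p, hp⟩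
    change L _ = 0
    rw [dual_segrePoint, segrePullback_eq, hL, multilinearForm_mulCoeff, map_mul, h0, zero_mul]
  exact hle hS

/-- The points of a closed subscheme of `ℙⁿ`. -/
def points (A : ProjSubscheme n) : Set (ℙ ℂ (Fin (n + 1) → ℂ)) :=
  {p | ∀ f ∈ A.ideal, eval p.rep f = 0}

end ProjSubscheme

theorem eval_smul_of_isHomogeneous {σ : Type*} {f : MvPolynomial σ ℂ} {d : ℕ}
    (hf : f.IsHomogeneous d) (a : ℂ) (x : σ → ℂ) : eval (a • x) f = a ^ d * eval x f := by
  rw [eval_eq, eval_eq, Finset.mul_sum]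
  refine Finset.sum_congr rfl fun m hm => ?_
  rw [hf.degree_eq_sum_deg_support hm]
  simp only [Pi.smul_apply, smul_eq_mul, mul_pow, Finset.prod_mul_distrib,
    Finset.prod_pow_eq_pow_sum]
  ring

theorem exists_linearForm_eval (W : Submodule ℂ (Fin (n + 1) → ℂ)) {x : Fin (n + 1) → ℂ}
    (hx : x ∉ W) : ∃ l : MvPolynomial (Fin (n + 1)) ℂ, l.IsHomogeneous 1 ∧ eval x l ≠ 0 ∧
      ∀ y ∈ W, eval y l = 0 := by
  obtain ⟨φ, hφ, hW⟩ := Submodule.exists_le_ker_of_notMem hx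
  have hev : ∀ y, eval y (∑ j, C (φ (Pi.single j 1)) * X j) = φ y := fun y => by
    conv_rhs => rw [← (Pi.basisFun ℂ (Fin (n + 1))).sum_repr y]
    simp [mul_comm]
  exact ⟨_, .sum _ _ _ fun j _ => isHomogeneous_C_mul_X _ _, by rwa [hev], fun y hy => by
    rw [hev]; exact hW hy⟩

/-- Finitely many points impose independent conditions on forms of large degree. -/
theorem exists_form_separating (S : Finset (ℙ ℂ (Fin (n + 1) → ℂ))) {p : ℙ ℂ (Fin (n + 1) → ℂ)}
    (hp : p ∈ S) (N : ℕ) :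
    ∃ f : MvPolynomial (Fin (n + 1)) ℂ, f.IsHomogeneous (N + (S.card - 1)) ∧
      eval p.rep f ≠ 0 ∧ ∀ q ∈ S, q ≠ p → eval q.rep f = 0 := by
  classical
  -- The form is a product of linear forms that vanish at one of the other points but not at `p`,
  -- and of a power of a linear form that does not vanish at `p`.
  have hl : ∀ q, q ≠ p → ∃ l : MvPolynomial (Fin (n + 1)) ℂ, l.IsHomogeneous 1 ∧
      eval p.rep l ≠ 0 ∧ eval q.rep l = 0 := by
    intro q hq
    have hpq : p.rep ∉ Submodule.span ℂ {q.rep} := fun h => hq <| by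
      obtain ⟨a, ha⟩ := Submodule.mem_span_singleton.1 h
      rw [← p.mk_rep, ← q.mk_rep]
      exact ((Projectivization.mk_eq_mk_iff' _ _ _ _ _).2 ⟨a, ha⟩).symm
    obtain ⟨l, h1, h2, h3⟩ := exists_linearForm_eval _ hpq
    exact ⟨l, h1, h2, h3 _ (Submodule.mem_span_singleton_self _)⟩
  choose! l hl₁ hlp hlq using hl
  obtain ⟨m, hm₁, hmp, -⟩ := exists_linearForm_eval ⊥ (x := p.rep) (by simpa using p.rep_nonzero)
  refine ⟨m ^ N * ∏ q ∈ S.erase p, l q, ?_, ?_, fun q hq hqp => ?_⟩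
  · have := (hm₁.pow N).mul (IsHomogeneous.prod (S.erase p) l (fun _ => 1)
      fun q hq => hl₁ q (Finset.ne_of_mem_erase hq))
    rwa [one_mul, Finset.sum_const, smul_eq_mul, mul_one, Finset.card_erase_of_mem hp] at this
  · rw [map_mul, map_pow, map_prod]
    exact mul_ne_zero (pow_ne_zero _ hmp) (Finset.prod_ne_zero_iff.2 fun q hq =>
      hlp q (Finset.ne_of_mem_erase hq))
  · rw [map_mul, map_prod, Finset.prod_eq_zero (Finset.mem_erase.2 ⟨hqp, hq⟩) (hlq q hqp),
      mul_zero]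

namespace ProjSubscheme

/-- A scheme of degree `r` has at most `r` points, since evaluation at the points is onto in large
degrees. -/
theorem card_le_of_subset_points {A : ProjSubscheme n} {r : ℕ} (hA : A.HasDegree r)
    {S : Finset (ℙ ℂ (Fin (n + 1) → ℂ))} (hS : (S : Set _) ⊆ A.points) : S.card ≤ r := by
  classical
  obtain ⟨N, hN⟩ := hA
  rw [← hN (N + (S.card - 1)) (Nat.le_add_right _ _)]
  have hsep := fun p : S => exists_form_separating S p.2 N
  choose f hf hfp hfq using hsep
  let ev : homogeneousSubmodule (Fin (n + 1)) ℂ (N + (S.card - 1)) →ₗ[ℂ] S → ℂ :=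
    LinearMap.pi fun p => (aeval p.1.rep).toLinearMap ∘ₗ Submodule.subtype _
  calc S.card = finrank ℂ (S → ℂ) := by simp
    _ = finrank ℂ ((S → ℂ) ⧸ (⊥ : Submodule ℂ (S → ℂ))) :=
      (Submodule.quotEquivOfEqBot _ rfl).finrank_eq.symm
    _ ≤ _ := finrank_quotient_le_of_forall_exists ev ?_ fun w => ?_
  · intro g hg
    exact funext fun p => hS p.2 _ hg
  · refine ⟨∑ p, (w p / eval p.1.rep (f p)) • ⟨f p, hf p⟩, (Submodule.mem_bot ℂ).2 ?_⟩
    refine sub_eq_zero.2 (funext fun q => ?_)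
    rw [map_sum, Finset.sum_apply, Finset.sum_eq_single q]
    · rw [map_smul]
      exact div_mul_cancel₀ _ (hfp q)
    · intro p _ hpq
      rw [map_smul]
      have : eval q.1.rep (f p) = 0 := hfq p q q.2 fun h => hpq (Subtype.ext h.symm)
      change _ * eval q.1.rep (f p) = 0
      rw [this, mul_zero]
    · simp

theorem exists_finset_eq_points {A : ProjSubscheme n} {r : ℕ} (hA : A.HasDegree r) :
    ∃ S : Finset (ℙ ℂ (Fin (n + 1) → ℂ)), (S : Set _) = A.points ∧ S.card ≤ r := by
  have hfin : A.points.Finite := by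
    by_contra h
    obtain ⟨S, hS, hcard⟩ := Set.Infinite.exists_subset_card_eq h (r + 1)
    have := card_le_of_subset_points hA hS
    lia
  exact ⟨hfin.toFinset, hfin.coe_toFinset, card_le_of_subset_points hA hfin.coe_toFinset.subset⟩

/-- A form that vanishes at all points of a reduced subscheme belongs to its ideal, by the
Nullstellensatz. -/
theorem mem_ideal_of_eval_eq_zero {A : ProjSubscheme n} (hA : A.IsReduced) {k : ℕ}
    {f : MvPolynomial (Fin (n + 1)) ℂ} (hf : f.IsHomogeneous k)
    (h : ∀ p ∈ A.points, eval p.rep f = 0) : f ∈ A.ideal := by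
  -- Multiplication by `X i` takes care of the origin, where a constant `f` need not vanish.
  refine A.saturated f fun i => ⟨1, ?_⟩
  rw [pow_one, ← Ideal.IsRadical.radical hA, ← vanishingIdeal_zeroLocus_eq_radical (K := ℂ),
    mem_vanishingIdeal_iff]
  intro x hx
  rw [map_mul, aeval_X]
  by_cases hx0 : x = 0
  · simp [hx0]
  obtain ⟨a, ha⟩ := Projectivization.exists_smul_eq_mk_rep ℂ x hx0
  have ha : (a : ℂ) • x = (Projectivization.mk ℂ x hx0).rep := ha
  have hp : Projectivization.mk ℂ x hx0 ∈ A.points := by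
    intro g hg
    rw [← ha, ← sum_homogeneousComponent g, map_sum]
    refine Finset.sum_eq_zero fun d _ => ?_
    rw [eval_smul_of_isHomogeneous (homogeneousComponent_isHomogeneous d g)]
    have : eval x (homogeneousComponent d g) = 0 := hx _ (A.homogeneous g hg d)
    rw [this, mul_zero]
  have h0 := h _ hp
  rw [← ha, eval_smul_of_isHomogeneous hf] at h0
  have : eval x f = 0 := (mul_eq_zero.1 h0).resolve_left (pow_ne_zero _ a.ne_zero)
  exact mul_eq_zero_of_right _ this

/-- If `A` is reduced, then `⟨v_k(A)⟩` is contained in the span of the images of its points. -/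
theorem veroneseSpan_le_span_points {A : ProjSubscheme n} (hA : A.IsReduced) (k : ℕ) :
    A.veroneseSpan k ≤
      Submodule.span ℂ ((fun p => segrePoint (k := k) fun _ => p) '' A.points) := by
  intro t ht
  by_contra hspan
  obtain ⟨L, hLt, hL⟩ := Submodule.exists_le_ker_of_notMem hspan
  refine hLt (mem_veroneseSpan.1 ht L ?_)
  rw [veronesePullback_eq]
  refine mem_ideal_of_eval_eq_zero hA (multilinearForm_isHomogeneous _ _) fun p hp => ?_
  have h0 : L (segrePoint fun _ => p) = 0 := hL (Submodule.subset_span ⟨p, hp, rfl⟩)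
  rw [dual_segrePoint, segrePullback_eq] at h0
  rw [← h0]
  simp [multilinearForm_apply]

end ProjSubscheme

end TensorRank

end

open TensorRank in
theorem corollary3p10 (n k c e : ℕ) (he : 2 * e ≤ k)
    (A : TensorRank.ProjSubscheme n) (hA : A.HasDegree (c + 1)) (hA1 : A.h1 e = 0)
    (T : ℙ ℂ (TensorRank.Tensor k n))
    (hT : T.submodule ≤ A.veroneseSpan k)
    (hmin : ∀ A' : TensorRank.ProjSubscheme n, A'.IsProperSubscheme A →
      ¬ T.submodule ≤ A'.veroneseSpan k) :
    TensorRank.IsCactusRank T (c + 1) ∧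
      (A.IsReduced → TensorRank.IsRank T (c + 1) ∧ TensorRank.IsSymmetricRank T (c + 1)) := by
  obtain ⟨e', rfl⟩ : ∃ e', k = e + e' := Nat.exists_eq_add_of_le (by lia)
  have hee' : e ≤ e' := by lia
  have hH := fun d => A.hilbertFunction_eq_of_h1_eq_zero hA hA1 (d := d)
  simp only [IsCactusRank, IsRank, IsSymmetricRank, T.submodule_eq,
    Submodule.span_singleton_le_iff_mem] at hT hmin ⊢
  have hrank : ∀ S : Finset (Fin (e + e') → ℙ ℂ (Fin (n + 1) → ℂ)),
      T.rep ∈ Submodule.span ℂ (segrePoint '' (S : Set _)) → c + 1 ≤ S.card :=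
    fun S hS => ProjSubscheme.le_card_of_mem_span hee' hH hT hmin hS
  refine ⟨⟨⟨A.diagonal _, ⟨1, fun u hu => le_antisymm ?_ ?_⟩, ?_⟩, ?_⟩, fun hred => ?_⟩
  · have hle : e ≤ ∑ i, u i := by
      calc e ≤ ∑ i : Fin (e + e'), 1 := by simp
        _ ≤ _ := Finset.sum_le_sum fun i _ => hu i
    exact (A.diagonal_hilbertFunction_le u).trans_eq (hH _ hle)
  · exact MultiProjSubscheme.le_hilbertFunction hee' hH hT hmin
      (A.veroneseSpan_le_diagonal_segreSpan _ hT) hu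
  · exact A.veroneseSpan_le_diagonal_segreSpan _ hT
  · rintro s ⟨Z, ⟨m, hm⟩, hZ⟩
    rw [← hm (fun _ => m + 1) fun _ => Nat.le_succ _]
    exact MultiProjSubscheme.le_hilbertFunction hee' hH hT hmin hZ fun _ => Nat.le_add_left _ _
  · classical
    have hsymm : ∀ S : Finset (ℙ ℂ (Fin (n + 1) → ℂ)), T.rep ∈ Submodule.span ℂ
        ((fun p => segrePoint (k := e + e') fun _ => p) '' (S : Set _)) →
        T.rep ∈ Submodule.span ℂ (segrePoint ''
          ((S.image fun p (_ : Fin (e + e')) => p : Finset _) : Set _)) := by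
      intro S hS
      rwa [Finset.coe_image, Set.image_image]
    obtain ⟨S, hS, hScard⟩ := ProjSubscheme.exists_finset_eq_points hA
    have hTS := ProjSubscheme.veroneseSpan_le_span_points hred _ hT
    rw [← hS] at hTS
    have h1 := hrank _ (hsymm S hTS)
    have h2 := Finset.card_image_le (s := S) (f := fun p (_ : Fin (e + e')) => p)
    -- `A` has at most `c + 1` points, and by the lower bound for the rank no fewer.
    refine ⟨⟨⟨_, by lia, hsymm S hTS⟩, ?_⟩, ⟨⟨S, by lia, hTS⟩, ?_⟩⟩
    · rintro s ⟨S', rfl, hS'⟩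
      exact hrank S' hS'
    · rintro s ⟨S', rfl, hS'⟩
      exact (hrank _ (hsymm S' hS')).trans Finset.card_image_le
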